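/- Let $\Omega\subseteq\mathbb R^n$ be a connected open set, and let $\mathcal M^+(\Omega)$ be the class of nonnegative locally finite Borel measures on $\Omega$. Let $G:\Omega\times\Omega\to[0,+\infty]$ be a lower semicontinuous kernel, and write $\mathbf G\nu(x)=\int_\Omega G(x,y)\,d\nu(y)$ for $\nu\in\mathcal M^+(\Omega)$. Assume that $G$ is quasi-symmetric: there is a constant $a>0$ with $a^{-1}G(x,y)\le G(y,x)\le a\,G(x,y)$ for all $x,y\in\Omega$. Assume also that $G$ satisfies the weak maximum principle: there is a constant $h\ge 1$ such that for every $\nu\in\mathcal M^+(\Omega)$ and every $M>0$, if $\mathbf G\nu\le M$ on $\operatorname{supp}\nu$, then $\mathbf G\nu\le hM$ on $\Omega$. For compact $K\subseteq\Omega$ let $$\operatorname{cap}(K)=\Big(\inf_\mu\int_\Omega\mathbf G\mu\,d\mu\Big)^{-1},$$ where the infimum is over all Borel probability measures $\mu$ on $\Omega$ with $\mu(\Omega\setminus K)=0$ (with $\inf\emptyset=\infty$, $1/\infty=0$, $1/0=\infty$). This is the (Wiener) inner capacity of $K$ with respect to $G$; the inner capacity of an arbitrary set is the supremum of $\operatorname{cap}$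 over its compact subsets. For a measurable $f:\Omega\to[0,\infty]$, $\sigma\in\mathcal M^+(\Omega)$ and $0<p<\infty$ let $\|f\|_{L^{p,\infty}(\sigma)}=\sup_{t>0}t\,\sigma(\{f>t\})^{1/p}$; $L^{p,\infty}(\sigma)$ consists of those $f$ for which this is finite. **Theorem.** Let $\sigma\in\mathcal M^+(\Omega)$ and $0<q<1$. Then the following statements are equivalent: 1. There is a constant $C>0$ such that $\|\mathbf G\nu\|_{L^{q,\infty}(\sigma)}\le C\,\nu(\Omega)$ for all $\nu\in\mathcal M^+(\Omega)$. 2. There is a constant $c>0$ such that $\sigma(K)\le c\,\operatorname{cap}(K)^q$ for all compact sets $K\subseteq\Omega$. 3. $\mathbf G\sigma\in L^{\frac{q}{1-q},\infty}(\sigma)$. -/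

import Mathlib

open MeasureTheory Topology
open scoped ENNReal NNReal

noncomputable section

namespace KernelPotential

variable {X : Type*}

/-- The potential `Gν(x) = ∫ G(x, y) dν(y)` of a measure `ν` with respect to a kernel `G`. -/
def potential [MeasurableSpace X] (G : X → X → ℝ≥0∞) (ν : Measure X) (x : X) : ℝ≥0∞ :=
  ∫⁻ y, G x y ∂ν

/-- `G` is quasi-symmetric: `a⁻¹ G(x, y) ≤ G(y, x) ≤ a G(x, y)` for some constant `a > 0`. -/
def QuasiSymmetric (G : X → X → ℝ≥0∞) : Prop :=
  ∃ a : ℝ≥0, 0 < a ∧ ∀ x y, (a : ℝ≥0∞)⁻¹ * G x y ≤ G y x ∧ G y x ≤ (a : ℝ≥0∞) * G x y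

/-- The weak maximum principle, with a constant `h ≥ 1` that depends only on the kernel:
if `Gν ≤ M` on the support of the locally finite measure `ν`, then `Gν ≤ h M` everywhere. -/
def WeakMaximumPrinciple [TopologicalSpace X] [MeasurableSpace X] (G : X → X → ℝ≥0∞) : Prop :=
  ∃ h : ℝ≥0, 1 ≤ h ∧ ∀ ν : Measure X, IsLocallyFiniteMeasure ν → ∀ M : ℝ≥0, 0 < M →
    (∀ x ∈ ν.support, potential G ν x ≤ M) → ∀ x, potential G ν x ≤ (h : ℝ≥0∞) * M

/-- The energy `∫∫ G(x, y) dμ(y) dμ(x)`. -/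
def energy [MeasurableSpace X] (G : X → X → ℝ≥0∞) (μ : Measure X) : ℝ≥0∞ :=
  ∫⁻ x, potential G μ x ∂μ

/-- The minimal energy of a probability measure carried by `K` (it is `∞` if there is none). -/
def wienerEnergy [MeasurableSpace X] (G : X → X → ℝ≥0∞) (K : Set X) : ℝ≥0∞ :=
  ⨅ (μ : Measure X) (_ : IsProbabilityMeasure μ) (_ : μ Kᶜ = 0), energy G μ

/-- The (Wiener) inner capacity of a set: the supremum of the capacities `1 / wienerEnergy G K`
of its compact subsets `K`, with `1 / ∞ = 0` and `1 / 0 = ∞`. -/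
def innerCapacity [TopologicalSpace X] [MeasurableSpace X] (G : X → X → ℝ≥0∞) (E : Set X) :
    ℝ≥0∞ :=
  ⨆ (K : Set X) (_ : IsCompact K) (_ : K ⊆ E), (wienerEnergy G K)⁻¹

/-- The quasi-norm of the weak Lebesgue space `L^{p,∞}(σ)`, `0 < p < ∞`, of a nonnegative
function: the supremum of `t σ{f > t}^{1/p}` over `t > 0` (the value `t = 0` contributes `0`). -/
def weakLpNorm [MeasurableSpace X] (f : X → ℝ≥0∞) (p : ℝ) (σ : Measure X) : ℝ≥0∞ :=
  ⨆ t : ℝ≥0, (t : ℝ≥0∞) * σ {x | (t : ℝ≥0∞) < f x} ^ (1 / p)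

/-- Membership of a nonnegative function in the weak Lebesgue space `L^{p,∞}(σ)`. -/
def MemWeakLp [MeasurableSpace X] (f : X → ℝ≥0∞) (p : ℝ) (σ : Measure X) : Prop :=
  AEMeasurable f σ ∧ weakLpNorm f p σ < ∞

end KernelPotential

end

/-!
The three conditions are proved equivalent in the cycle weak type bound ⇒ weak `L^{q/(1-q)}` bound
⇒ capacity bound ⇒ weak type bound. Potentials are lower semicontinuous, so their superlevel sets
are open and their sublevel sets closed; this is what makes the maximum principle applicable to
truncated measures, whose supports stay inside such closed sets.

* *Weak type ⇒ weak `L^{q/(1-q)}`.* For a finite `μ ≤ σ` put `E = {Gμ > t}`. The part of `μ` outside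
  `E` has potential at most `t` on its support, hence at most `ht` everywhere, so
  `{Gμ > 2ht} ⊆ {G(μ|E) > ht}` and the weak type bound for `μ|E` gives
  `μ {Gμ > 2ht} ≤ (C μ{Gμ > t} / (ht)) ^ q`. Since `q < 1`, this self-improves to a decay
  `μ {Gμ > t} = O(t ^ (-q/(1-q)))` with a constant independent of `μ`
  (`rpow_mul_le_of_iterated_bound`). Exhausting the space by compact sets concludes.

* *Weak `L^{q/(1-q)}` ⇒ capacity bound.* The potential `Gσ` is at most a multiple of
  `σ(K) ^ (-(1-q)/q)` on a closed subset of `K` carrying half of its mass; the normalised restriction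
  of `σ` to that subset is a competitor for the minimal energy of `K`.

* *Capacity bound ⇒ weak type.* Let `μ` be a probability measure on a compact `K ⊆ {Gν > t}`, of
  energy less than `e`. By Chebyshev's inequality, half of the mass of `μ` lies where `Gμ ≤ 2e`; the
  maximum principle bounds the potential of this half everywhere, and integrating `Gν` against it
  and exchanging the integrals gives `t ≤ 4ahe ν(Ω)` (`le_of_energy_lt`). No equilibrium measure is
  needed. Thus every such `K` has capacity at most `4ah ν(Ω) / t`.
-/

open MeasureTheory Topology Filter Set
open scoped ENNReal NNReal

namespace KernelPotential

/-! ### A real-variable self-improvement lemma -/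

/-- A bounded `m` with `m (k t) ≤ (C m(t) / t) ^ q` and `q < 1` decays like `t ^ (-q/(1-q))`, with a
constant that does not depend on the a priori bound `M`. -/
theorem rpow_mul_le_of_iterated_bound {q C k M : ℝ} (hq : 0 < q) (hq1 : q < 1) (hC : 0 ≤ C)
    (hk : 1 ≤ k) (m : ℝ → ℝ) (hm0 : ∀ t, 0 ≤ m t) (hmM : ∀ t, m t ≤ M)
    (H : ∀ t, 0 < t → m (k * t) ≤ (C / t * m t) ^ q) {T : ℝ} (hT : 0 < T) :
    T ^ (q / (1 - q)) * m T ≤ (k ^ (q / (1 - q)) * C ^ q) ^ (1 / (1 - q)) := by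
  have hq' : 0 < 1 - q := by linarith
  set r := q / (1 - q) with hr
  have hr0 : 0 < r := div_pos hq hq'
  have hrq : r = q + r * q := by rw [hr]; field_simp; ring
  have hk0 : 0 < k := by linarith
  set D := k ^ r * C ^ q with hD
  have hD0 : 0 ≤ D := by positivity
  set u : ℝ → ℝ := fun t => t ^ r * m t with hu
  have hu0 : ∀ t, 0 < t → 0 ≤ u t := fun t ht => mul_nonneg (by positivity) (hm0 t)
  have step : ∀ t, 0 < t → u (k * t) ≤ D * u t ^ q := by
    intro t ht
    have e1 : (C / t * m t) ^ q = C ^ q * t ^ (-q) * m t ^ q := by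
      rw [Real.mul_rpow (by positivity) (hm0 t), Real.div_rpow hC ht.le, Real.rpow_neg ht.le]
      rfl
    have e2 : u t ^ q = t ^ (r * q) * m t ^ q := by
      simp only [hu]
      rw [Real.mul_rpow (by positivity) (hm0 t), Real.rpow_mul ht.le]
    have e3 : t ^ r * t ^ (-q) = t ^ (r * q) := by
      rw [← Real.rpow_add ht]; congr 1; linarith
    calc u (k * t) = k ^ r * t ^ r * m (k * t) := by
          simp only [hu]; rw [Real.mul_rpow hk0.le ht.le]
      _ ≤ k ^ r * t ^ r * (C / t * m t) ^ q := by gcongr; exact H t ht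
      _ = D * ((t ^ r * t ^ (-q)) * m t ^ q) := by rw [e1, hD]; ring
      _ = D * u t ^ q := by rw [e3, e2]
  -- The supremum over `(0, T]` is finite by the a priori bound, so `S ≤ D * S ^ q` can be solved.
  set S := sSup (u '' Ioc 0 T) with hS
  have hbdd : BddAbove (u '' Ioc 0 T) := by
    refine ⟨T ^ r * M, ?_⟩
    rintro _ ⟨t, ⟨ht, htT⟩, rfl⟩
    exact mul_le_mul (Real.rpow_le_rpow ht.le htT hr0.le) (hmM t) (hm0 t) (by positivity)
  have hle : ∀ t, 0 < t → t ≤ T → u t ≤ S := fun t h1 h2 =>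
    le_csSup hbdd ⟨t, ⟨h1, h2⟩, rfl⟩
  have hS0 : 0 ≤ S := (hu0 T hT).trans (hle T hT le_rfl)
  have hSS : S ≤ D * S ^ q := by
    refine csSup_le ⟨_, T, ⟨hT, le_rfl⟩, rfl⟩ ?_
    rintro _ ⟨t, ⟨ht, htT⟩, rfl⟩
    have htk : 0 < t / k := by positivity
    have h1 := step (t / k) htk
    rw [mul_div_cancel₀ _ hk0.ne'] at h1
    refine h1.trans ?_
    gcongr
    · exact hu0 _ htk
    · exact hle _ htk ((div_le_self ht.le hk).trans htT)
  refine (hle T hT le_rfl).trans ?_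
  rcases hS0.eq_or_lt with h0 | h0
  · rw [← h0]; positivity
  have h1 : S ^ (1 - q) ≤ D := by
    rw [Real.rpow_sub h0, Real.rpow_one, div_le_iff₀ (by positivity)]
    exact hSS
  calc S = (S ^ (1 - q)) ^ (1 / (1 - q)) := by
        rw [← Real.rpow_mul h0.le, mul_one_div_cancel hq'.ne', Real.rpow_one]
    _ ≤ D ^ (1 / (1 - q)) := by gcongr

/-! ### Potentials of lower semicontinuous kernels -/

section

variable {X : Type*} [MeasurableSpace X] {G : X → X → ℝ≥0∞}

theorem potential_mono {μ ν : Measure X} (h : μ ≤ ν) (x : X) :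
    potential G μ x ≤ potential G ν x :=
  lintegral_mono' h le_rfl

theorem potential_restrict_add_compl (μ : Measure X) {E : Set X} (hE : MeasurableSet E) (x : X) :
    potential G (μ.restrict E) x + potential G (μ.restrict Eᶜ) x = potential G μ x :=
  lintegral_add_compl _ hE

variable [MetricSpace X] [BorelSpace X]

theorem support_restrict_subset_of_isClosed (μ : Measure X) {F : Set X} (hF : IsClosed F) :
    (μ.restrict F).support ⊆ F :=
  (Measure.support_restrict_subset.trans inter_subset_left).trans hF.closure_eq.subset

theorem lowerSemicontinuous_potential
    (hG : LowerSemicontinuous (fun z : X × X => G z.1 z.2)) (ν : Measure X) :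
    LowerSemicontinuous (potential G ν) := by
  have hy : ∀ y, LowerSemicontinuous fun x => G x y := fun y =>
    hG.comp (continuous_id.prodMk continuous_const)
  have hx : ∀ x, Measurable (G x) := fun x =>
    (hG.comp (continuous_const.prodMk continuous_id) : LowerSemicontinuous (G x)).measurable
  rw [lowerSemicontinuous_iff_le_liminf]
  intro x
  calc potential G ν x ≤ ∫⁻ y, liminf (fun x' => G x' y) (𝓝 x) ∂ν :=
        lintegral_mono fun y => (hy y).le_liminf x
    _ ≤ liminf (potential G ν) (𝓝 x) := lintegral_liminf_le hx

theorem measurable_potential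
    (hG : LowerSemicontinuous (fun z : X × X => G z.1 z.2)) (ν : Measure X) :
    Measurable (potential G ν) :=
  (lowerSemicontinuous_potential hG ν).measurable

theorem isOpen_lt_potential
    (hG : LowerSemicontinuous (fun z : X × X => G z.1 z.2)) (ν : Measure X) (t : ℝ≥0∞) :
    IsOpen {x | t < potential G ν x} :=
  (lowerSemicontinuous_potential hG ν).isOpen_preimage t

theorem isClosed_potential_le
    (hG : LowerSemicontinuous (fun z : X × X => G z.1 z.2)) (ν : Measure X) (t : ℝ≥0∞) :
    IsClosed {x | potential G ν x ≤ t} :=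
  (lowerSemicontinuous_potential hG ν).isClosed_preimage t

/-- The competitor for the minimal energy is the normalised restriction of `σ` to `F`. -/
theorem wienerEnergy_le_of_potential_le
    (σ : Measure X) {K F : Set X} (hF : IsClosed F) (hFK : F ⊆ K) (h0 : σ F ≠ 0) (h1 : σ F ≠ ∞)
    {t : ℝ≥0∞} (hFt : ∀ x ∈ F, potential G σ x ≤ t) :
    wienerEnergy G K ≤ t / σ F := by
  set μ : Measure X := (σ F)⁻¹ • σ.restrict F with hμ
  have hprob : IsProbabilityMeasure μ := ⟨by simp [hμ, ENNReal.inv_mul_cancel h0 h1]⟩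
  have hμK : μ Kᶜ = 0 := by
    have : σ (Kᶜ ∩ F) = 0 := by
      rw [(disjoint_compl_left_iff_subset.2 hFK).inter_eq, measure_empty]
    simp [hμ, Measure.restrict_apply' hF.measurableSet, this]
  refine (iInf_le_of_le μ (iInf_le_of_le hprob (iInf_le_of_le hμK le_rfl))).trans ?_
  have hpot : ∀ x ∈ F, potential G μ x ≤ (σ F)⁻¹ * t := by
    intro x hx
    simp only [potential, hμ, lintegral_smul_measure, smul_eq_mul]
    gcongr
    exact (potential_mono Measure.restrict_le_self x).trans (hFt x hx)
  calc energy G μ = (σ F)⁻¹ * ∫⁻ x in F, potential G μ x ∂σ := by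
        simp only [energy]
        conv_lhs => rw [hμ]
        rw [lintegral_smul_measure, smul_eq_mul]
    _ ≤ (σ F)⁻¹ * ∫⁻ _ in F, (σ F)⁻¹ * t ∂σ := by
        exact mul_le_mul_right (setLIntegral_mono' hF.measurableSet hpot) _
    _ = ((σ F)⁻¹ * σ F) * (t * (σ F)⁻¹) := by rw [setLIntegral_const]; ring
    _ = t / σ F := by rw [ENNReal.inv_mul_cancel h0 h1, one_mul, div_eq_mul_inv]

variable [SecondCountableTopology X]

/-- The exchange of integrals: for a quasi-symmetric kernel, the potential operator is its own
adjoint up to the constant `a`. -/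
theorem lintegral_potential_le {a : ℝ≥0}
    (hG : LowerSemicontinuous (fun z : X × X => G z.1 z.2)) (ha : ∀ x y, G y x ≤ a * G x y)
    (μ ν : Measure X) [SFinite μ] [SFinite ν] :
    ∫⁻ x, potential G ν x ∂μ ≤ a * ∫⁻ y, potential G μ y ∂ν := by
  have hm : Measurable (Function.uncurry G) := hG.measurable
  calc ∫⁻ x, potential G ν x ∂μ = ∫⁻ y, ∫⁻ x, G x y ∂μ ∂ν :=
        lintegral_lintegral_swap hm.aemeasurable
    _ ≤ ∫⁻ y, a * potential G μ y ∂ν := by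
        refine lintegral_mono fun y => ?_
        calc ∫⁻ x, G x y ∂μ ≤ ∫⁻ x, a * G y x ∂μ := lintegral_mono fun x => ha y x
          _ = a * potential G μ y := lintegral_const_mul' _ _ ENNReal.coe_ne_top
    _ = a * ∫⁻ y, potential G μ y ∂ν := lintegral_const_mul' _ _ ENNReal.coe_ne_top

variable [LocallyCompactSpace X]

/-! ### From capacity to the weak type bound -/

/-- A probability measure carried by a compact subset of `{Gν > t}` cannot have small energy. -/
theorem le_of_energy_lt {a h : ℝ≥0}
    (hG : LowerSemicontinuous (fun z : X × X => G z.1 z.2)) (ha : ∀ x y, G y x ≤ a * G x y)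
    (hh : ∀ ν : Measure X, IsLocallyFiniteMeasure ν → ∀ M : ℝ≥0, 0 < M →
      (∀ x ∈ ν.support, potential G ν x ≤ M) → ∀ x, potential G ν x ≤ (h : ℝ≥0∞) * M)
    (ν : Measure X) [IsFiniteMeasure ν] {K : Set X} (hK : IsCompact K) {t : ℝ≥0}
    (hKt : ∀ x ∈ K, t < potential G ν x) (μ : Measure X) [IsProbabilityMeasure μ]
    (hμK : μ Kᶜ = 0) {e : ℝ≥0} (he : energy G μ < e) :
    (t : ℝ≥0∞) ≤ 4 * a * h * ν univ * e := by
  have he0 : e ≠ 0 := by rintro rfl; simp at he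
  set S := {x | 2 * (e : ℝ≥0∞) ≤ potential G μ x} with hS
  set F := K ∩ {x | potential G μ x ≤ 2 * (e : ℝ≥0∞)} with hF
  have hFc : IsClosed F := hK.isClosed.inter (isClosed_potential_le hG μ _)
  -- Chebyshev's inequality: at least half of the mass lies in `F`.
  have hS2 : 2 * μ S ≤ 1 := by
    have h1 : (e : ℝ≥0∞) * (2 * μ S) ≤ e * 1 := by
      calc (e : ℝ≥0∞) * (2 * μ S) = 2 * e * μ S := by ring
        _ ≤ energy G μ := mul_meas_ge_le_lintegral (measurable_potential hG μ) _
        _ ≤ e * 1 := by rw [mul_one]; exact he.le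
    exact (ENNReal.mul_le_mul_iff_right (by simpa using he0) ENNReal.coe_ne_top).1 h1
  have hF2 : 1 ≤ 2 * μ F := by
    have hcov : (univ : Set X) ⊆ F ∪ (Kᶜ ∪ S) := by
      intro x _
      by_cases hxK : x ∈ K
      · rcases le_total (potential G μ x) (2 * (e : ℝ≥0∞)) with hx | hx
        · exact Or.inl ⟨hxK, hx⟩
        · exact Or.inr (Or.inr hx)
      · exact Or.inr (Or.inl hxK)
    have h1 : 1 ≤ μ F + μ S := by
      calc (1 : ℝ≥0∞) = μ univ := measure_univ.symm
        _ ≤ μ (F ∪ (Kᶜ ∪ S)) := measure_mono hcov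
        _ ≤ μ F + (μ Kᶜ + μ S) :=
          (measure_union_le _ _).trans (add_le_add le_rfl (measure_union_le _ _))
        _ = μ F + μ S := by rw [hμK, zero_add]
    have h2 : (1 : ℝ≥0∞) + 1 ≤ 2 * μ F + 1 := by
      calc (1 : ℝ≥0∞) + 1 = 2 * 1 := by norm_num
        _ ≤ 2 * (μ F + μ S) := by gcongr
        _ = 2 * μ F + 2 * μ S := by ring
        _ ≤ 2 * μ F + 1 := by gcongr
    exact (ENNReal.add_le_add_iff_right ENNReal.one_ne_top).1 h2
  have hpot : ∀ x, potential G (μ.restrict F) x ≤ h * ((2 * e : ℝ≥0) : ℝ≥0∞) := by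
    refine hh _ inferInstance (2 * e) (by positivity) fun x hx => ?_
    refine (potential_mono Measure.restrict_le_self x).trans ?_
    have := (support_restrict_subset_of_isClosed μ hFc hx).2
    simpa using this
  have hmain : (t : ℝ≥0∞) * μ F ≤ a * (h * (2 * e) * ν univ) := by
    calc (t : ℝ≥0∞) * μ F = ∫⁻ _ in F, (t : ℝ≥0∞) ∂μ := (setLIntegral_const _ _).symm
      _ ≤ ∫⁻ x in F, potential G ν x ∂μ :=
        setLIntegral_mono (measurable_potential hG ν) fun x hx => (hKt x hx.1).le
      _ ≤ a * ∫⁻ y, potential G (μ.restrict F) y ∂ν := lintegral_potential_le hG ha _ _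
      _ ≤ a * ∫⁻ _, h * (2 * e) ∂ν := by
        gcongr with y
        simpa using hpot y
      _ = a * (h * (2 * e) * ν univ) := by rw [lintegral_const]
  calc (t : ℝ≥0∞) = t * 1 := (mul_one _).symm
    _ ≤ t * (2 * μ F) := by gcongr
    _ = 2 * (t * μ F) := by ring
    _ ≤ 2 * (a * (h * (2 * e) * ν univ)) := by gcongr
    _ = 4 * a * h * ν univ * e := by ring

theorem innerCapacity_le_of_subset_lt_potential {a h : ℝ≥0}
    (hG : LowerSemicontinuous (fun z : X × X => G z.1 z.2)) (ha : ∀ x y, G y x ≤ a * G x y)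
    (hh : ∀ ν : Measure X, IsLocallyFiniteMeasure ν → ∀ M : ℝ≥0, 0 < M →
      (∀ x ∈ ν.support, potential G ν x ≤ M) → ∀ x, potential G ν x ≤ (h : ℝ≥0∞) * M)
    (ν : Measure X) [IsFiniteMeasure ν] {E : Set X} {t : ℝ≥0} (ht : t ≠ 0)
    (hEt : ∀ x ∈ E, t < potential G ν x) :
    innerCapacity G E ≤ 4 * a * h * ν univ / t := by
  refine iSup_le fun K => iSup_le fun hK => iSup_le fun hKE => ?_
  rw [← ENNReal.inv_div (Or.inr ENNReal.coe_ne_top) (Or.inr (by simpa using ht)),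
    ENNReal.inv_le_inv]
  refine le_iInf fun μ => le_iInf fun hμ => le_iInf fun hμK => ?_
  by_contra! hlt
  obtain ⟨e, he, he'⟩ := ENNReal.lt_iff_exists_nnreal_btwn.1 hlt
  exact he'.not_ge (ENNReal.div_le_of_le_mul'
    (le_of_energy_lt hG ha hh ν hK (fun x hx => hEt x (hKE hx)) μ hμK he))

theorem weakLpNorm_potential_le_of_capacity_bound {a h : ℝ≥0}
    (hG : LowerSemicontinuous (fun z : X × X => G z.1 z.2)) (ha : ∀ x y, G y x ≤ a * G x y)
    (hh : ∀ ν : Measure X, IsLocallyFiniteMeasure ν → ∀ M : ℝ≥0, 0 < M →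
      (∀ x ∈ ν.support, potential G ν x ≤ M) → ∀ x, potential G ν x ≤ (h : ℝ≥0∞) * M)
    (σ : Measure X) [IsLocallyFiniteMeasure σ] {q : ℝ} (hq : 0 < q) {c : ℝ≥0}
    (hc : ∀ K : Set X, IsCompact K → σ K ≤ c * innerCapacity G K ^ q)
    (ν : Measure X) [IsFiniteMeasure ν] :
    weakLpNorm (potential G ν) q σ ≤ (c : ℝ≥0∞) ^ (1 / q) * (4 * a * h * ν univ) := by
  refine iSup_le fun t => ?_
  rcases eq_or_ne t 0 with rfl | ht
  · simp
  have ht' : (t : ℝ≥0∞) ≠ 0 := by simpa using ht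
  have hσ : σ {x | (t : ℝ≥0∞) < potential G ν x} ≤ c * (4 * a * h * ν univ / t) ^ q := by
    rw [(isOpen_lt_potential hG ν t).measure_eq_iSup_isCompact]
    refine iSup_le fun K => iSup_le fun hKt => iSup_le fun hK => (hc K hK).trans ?_
    gcongr
    exact innerCapacity_le_of_subset_lt_potential hG ha hh ν ht hKt
  have hq' : 0 ≤ 1 / q := by positivity
  calc (t : ℝ≥0∞) * σ {x | (t : ℝ≥0∞) < potential G ν x} ^ (1 / q)
      ≤ t * (c * (4 * a * h * ν univ / t) ^ q) ^ (1 / q) := by gcongr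
    _ = (c : ℝ≥0∞) ^ (1 / q) * (t * (4 * a * h * ν univ / t)) := by
        rw [ENNReal.mul_rpow_of_nonneg _ _ hq', ← ENNReal.rpow_mul,
          mul_one_div_cancel hq.ne', ENNReal.rpow_one]
        ring
    _ = (c : ℝ≥0∞) ^ (1 / q) * (4 * a * h * ν univ) := by
        rw [ENNReal.mul_div_cancel ht' ENNReal.coe_ne_top]

/-! ### From the weak Lebesgue bound on the potential of `σ` to capacity -/

theorem measure_le_innerCapacity_of_memWeakLp
    (hG : LowerSemicontinuous (fun z : X × X => G z.1 z.2)) (σ : Measure X)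
    [IsLocallyFiniteMeasure σ] {q : ℝ} (hq : 0 < q) (hq1 : q < 1) {A : ℝ≥0} (hA : 0 < A)
    (hσA : weakLpNorm (potential G σ) (q / (1 - q)) σ < A) {K : Set X} (hK : IsCompact K) :
    σ K ≤ ((2 * A ^ q : ℝ≥0) : ℝ≥0∞) * innerCapacity G K ^ q := by
  have hq' : 0 < 1 - q := by linarith
  rcases eq_or_ne (σ K) 0 with h0 | h0
  · simp [h0]
  have hKtop : σ K ≠ ∞ := hK.measure_lt_top.ne
  obtain ⟨s, hs⟩ : ∃ s : ℝ≥0, (s : ℝ≥0∞) = σ K / 2 :=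
    ⟨(σ K / 2).toNNReal, ENNReal.coe_toNNReal (ENNReal.div_ne_top hKtop (by norm_num))⟩
  have hs0 : s ≠ 0 := by
    rintro rfl
    have : σ K / 2 = 0 := by simpa using hs.symm
    simp [ENNReal.div_eq_zero_iff, h0] at this
  have hss : (s : ℝ≥0∞) + s = σ K := by rw [hs, ENNReal.add_halves]
  have hp : 1 / (q / (1 - q)) = (1 - q) / q := by rw [one_div_div]
  -- The level `t` is chosen so that `{Gσ > t}` has measure less than `s = σ K / 2`.
  set t : ℝ≥0 := A * s ^ (-((1 - q) / q)) with ht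
  have hsmall : σ {x | (t : ℝ≥0∞) < potential G σ x} < s := by
    by_contra! hcon
    have h1 : (t : ℝ≥0∞) * σ {x | (t : ℝ≥0∞) < potential G σ x} ^ (1 / (q / (1 - q))) < A :=
      (le_iSup (fun t : ℝ≥0 => (t : ℝ≥0∞) *
        σ {x | (t : ℝ≥0∞) < potential G σ x} ^ (1 / (q / (1 - q)))) t).trans_lt hσA
    rw [hp] at h1
    have h2 : (A : ℝ≥0∞) ≤
        t * σ {x | (t : ℝ≥0∞) < potential G σ x} ^ ((1 - q) / q) := by
      calc (A : ℝ≥0∞) = ((t * s ^ ((1 - q) / q) : ℝ≥0) : ℝ≥0∞) := by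
            rw [ht, mul_assoc, ← NNReal.rpow_add hs0, neg_add_cancel, NNReal.rpow_zero, mul_one]
        _ = t * (s : ℝ≥0∞) ^ ((1 - q) / q) := by
            rw [ENNReal.coe_mul, ENNReal.coe_rpow_of_nonneg _ (by positivity)]
        _ ≤ _ := by gcongr
    exact absurd h1 h2.not_gt
  set F := K ∩ {x | potential G σ x ≤ t} with hF
  have hFc : IsClosed F := hK.isClosed.inter (isClosed_potential_le hG σ _)
  have hFs : (s : ℝ≥0∞) ≤ σ F := by
    have h1 : (s : ℝ≥0∞) + s ≤ σ F + s := by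
      calc (s : ℝ≥0∞) + s = σ K := hss
        _ ≤ σ (F ∪ {x | (t : ℝ≥0∞) < potential G σ x}) := by
          refine measure_mono fun x hx => ?_
          rcases le_or_gt (potential G σ x) t with h | h
          · exact Or.inl ⟨hx, h⟩
          · exact Or.inr h
        _ ≤ σ F + σ {x | (t : ℝ≥0∞) < potential G σ x} := measure_union_le _ _
        _ ≤ σ F + s := by gcongr
    exact (ENNReal.add_le_add_iff_right ENNReal.coe_ne_top).1 h1
  have hs0' : (s : ℝ≥0∞) ≠ 0 := by simpa using hs0
  have hF0 : σ F ≠ 0 := fun h => hs0' (le_antisymm (h ▸ hFs) bot_le)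
  have hFtop : σ F ≠ ∞ := ((measure_mono inter_subset_left).trans_lt hK.measure_lt_top).ne
  have hW : wienerEnergy G K ≤ (t / s : ℝ≥0) := by
    refine (wienerEnergy_le_of_potential_le σ hFc inter_subset_left hF0 hFtop
      fun x hx => hx.2).trans ?_
    rw [ENNReal.coe_div hs0]
    gcongr
  have ht0 : t ≠ 0 := (mul_pos hA (NNReal.rpow_pos (pos_iff_ne_zero.2 hs0))).ne'
  have hcap : ((s / t : ℝ≥0) : ℝ≥0∞) ≤ innerCapacity G K := by
    refine le_trans ?_ (le_iSup_of_le K (le_iSup_of_le hK (le_iSup_of_le subset_rfl le_rfl)))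
    rw [← inv_div, ENNReal.coe_inv (div_ne_zero ht0 hs0), ENNReal.inv_le_inv]
    exact hW
  have hpow : A ^ q * (s / t) ^ q = s := by
    have : s / t = A⁻¹ * s ^ (1 / q) := by
      rw [ht, NNReal.rpow_neg, div_eq_mul_inv, mul_inv, inv_inv,
        show (1 : ℝ) / q = 1 + (1 - q) / q by field_simp; ring, NNReal.rpow_add hs0,
        NNReal.rpow_one]
      ring
    rw [← NNReal.mul_rpow, this, ← mul_assoc, mul_inv_cancel₀ hA.ne', one_mul, ← NNReal.rpow_mul,
      one_div_mul_cancel hq.ne', NNReal.rpow_one]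
  calc σ K = ((2 * (A ^ q * (s / t) ^ q) : ℝ≥0) : ℝ≥0∞) := by
        rw [hpow, ← hss, two_mul, ENNReal.coe_add]
    _ = ((2 * A ^ q : ℝ≥0) : ℝ≥0∞) * ((s / t : ℝ≥0) : ℝ≥0∞) ^ q := by
        rw [← ENNReal.coe_rpow_of_nonneg _ hq.le, ← ENNReal.coe_mul, mul_assoc]
    _ ≤ _ := by gcongr

/-! ### From the weak type bound to the weak Lebesgue bound on the potential of `σ` -/

/-- The part of `μ` outside `{Gμ > t}` has potential at most `h t` everywhere. -/
theorem setOf_lt_potential_subset {h : ℝ≥0}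
    (hG : LowerSemicontinuous (fun z : X × X => G z.1 z.2))
    (hh : ∀ ν : Measure X, IsLocallyFiniteMeasure ν → ∀ M : ℝ≥0, 0 < M →
      (∀ x ∈ ν.support, potential G ν x ≤ M) → ∀ x, potential G ν x ≤ (h : ℝ≥0∞) * M)
    (μ : Measure X) [IsFiniteMeasure μ] {t : ℝ≥0} (ht : 0 < t) :
    {x | ((2 * h * t : ℝ≥0) : ℝ≥0∞) < potential G μ x} ⊆
      {x | ((h * t : ℝ≥0) : ℝ≥0∞) <
        potential G (μ.restrict {x | (t : ℝ≥0∞) < potential G μ x}) x} := by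
  set E := {x | (t : ℝ≥0∞) < potential G μ x} with hE
  have hEo : IsOpen E := isOpen_lt_potential hG μ t
  intro x hx
  have h1 : potential G (μ.restrict Eᶜ) x ≤ h * t := by
    refine hh _ inferInstance t ht (fun y hy => ?_) x
    have hy' := support_restrict_subset_of_isClosed μ hEo.isClosed_compl hy
    exact (potential_mono Measure.restrict_le_self y).trans (not_lt.1 hy')
  have h2 := potential_restrict_add_compl (G := G) μ hEo.measurableSet x
  by_contra hcon
  have h3 : potential G (μ.restrict E) x ≤ h * t := by simpa using hcon
  refine absurd (show _ < potential G μ x from hx) (not_lt.2 ?_)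
  rw [← h2]
  refine (add_le_add h3 h1).trans_eq ?_
  push_cast
  ring

/-- The weak type bound for a finite measure `μ` forces a decay of `μ {Gμ > t}` at a rate that only
depends on the constants. -/
theorem measure_lt_potential_le {h C : ℝ≥0} (h1 : 1 ≤ h)
    (hG : LowerSemicontinuous (fun z : X × X => G z.1 z.2))
    (hh : ∀ ν : Measure X, IsLocallyFiniteMeasure ν → ∀ M : ℝ≥0, 0 < M →
      (∀ x ∈ ν.support, potential G ν x ≤ M) → ∀ x, potential G ν x ≤ (h : ℝ≥0∞) * M)
    {q : ℝ} (hq : 0 < q) (hq1 : q < 1) (μ : Measure X) [IsFiniteMeasure μ]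
    (hC : ∀ ν : Measure X, IsLocallyFiniteMeasure ν →
      weakLpNorm (potential G ν) q μ ≤ (C : ℝ≥0∞) * ν univ) {t : ℝ≥0} (ht : 0 < t) :
    (t : ℝ) ^ (q / (1 - q)) * μ.real {x | (t : ℝ≥0∞) < potential G μ x} ≤
      ((2 * h : ℝ) ^ (q / (1 - q)) * (C / h : ℝ) ^ q) ^ (1 / (1 - q)) := by
  have hh0 : 0 < h := lt_of_lt_of_le one_pos h1
  have hh1 : (1 : ℝ) ≤ h := by exact_mod_cast h1
  have key := rpow_mul_le_of_iterated_bound (q := q) (C := (C / h : ℝ)) (k := 2 * h)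
    (M := μ.real univ) hq hq1 (by positivity) (by linarith)
    (fun s => μ.real {x | (s.toNNReal : ℝ≥0∞) < potential G μ x})
    (fun s => measureReal_nonneg) (fun s => measureReal_mono (subset_univ _)) ?_
    (T := t) (by exact_mod_cast ht)
  · simpa using key
  intro s hs
  lift s to ℝ≥0 using hs.le
  have hs0 : 0 < s := by exact_mod_cast hs
  have e1 : ((2 * h : ℝ) * (s : ℝ)).toNNReal = 2 * h * s := by
    rw [show (2 * h : ℝ) * (s : ℝ) = ((2 * h * s : ℝ≥0) : ℝ) by push_cast; ring,
      Real.toNNReal_coe]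
  simp only [e1, Real.toNNReal_coe]
  set E := {x | (s : ℝ≥0∞) < potential G μ x} with hE
  set E' := {x | ((2 * h * s : ℝ≥0) : ℝ≥0∞) < potential G μ x} with hE'
  have hweak : ((h * s : ℝ≥0) : ℝ≥0∞) * μ E' ^ (1 / q) ≤ C * μ E := by
    calc ((h * s : ℝ≥0) : ℝ≥0∞) * μ E' ^ (1 / q)
        ≤ ((h * s : ℝ≥0) : ℝ≥0∞) *
          μ {x | ((h * s : ℝ≥0) : ℝ≥0∞) < potential G (μ.restrict E) x} ^ (1 / q) := by
          gcongr
          exact setOf_lt_potential_subset hG hh μ hs0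
      _ ≤ weakLpNorm (potential G (μ.restrict E)) q μ :=
          le_iSup (fun t : ℝ≥0 => (t : ℝ≥0∞) *
            μ {x | (t : ℝ≥0∞) < potential G (μ.restrict E) x} ^ (1 / q)) (h * s)
      _ ≤ C * (μ.restrict E) univ := hC _ inferInstance
      _ = C * μ E := by rw [Measure.restrict_apply_univ]
  have hreal : (h * s : ℝ) * μ.real E' ^ (1 / q) ≤ C * μ.real E := by
    have := ENNReal.toReal_mono
      (ENNReal.mul_ne_top ENNReal.coe_ne_top (measure_ne_top μ E)) hweak
    simpa [ENNReal.toReal_mul, ← ENNReal.toReal_rpow, Measure.real] using this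
  have h2 : μ.real E' ^ (1 / q) ≤ (C / h : ℝ) / s * μ.real E := by
    have hhs : (0 : ℝ) < h * s := by positivity
    rw [div_div, div_mul_eq_mul_div, le_div_iff₀ hhs, mul_comm]
    exact hreal
  calc μ.real E' = (μ.real E' ^ (1 / q)) ^ q := by
        rw [← Real.rpow_mul measureReal_nonneg, one_div_mul_cancel hq.ne', Real.rpow_one]
    _ ≤ ((C / h : ℝ) / s * μ.real E) ^ q := by gcongr

/-- The compact exhaustion: bounds for the restrictions of `σ` to compact sets pass to `σ`. -/
theorem measure_lt_potential_le_of_forall_isCompact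
    (hG : LowerSemicontinuous (fun z : X × X => G z.1 z.2)) (σ : Measure X) {t B : ℝ≥0∞}
    (hB : ∀ K : Set X, IsCompact K →
      σ.restrict K {x | t < potential G (σ.restrict K) x} ≤ B) :
    σ {x | t < potential G σ x} ≤ B := by
  set K : ℕ → Set X := compactCovering X with hK
  have hKmono : Monotone K := fun m n hmn => compactCovering_subset X hmn
  have hKc : ∀ n, IsCompact (K n) := isCompact_compactCovering X
  set A : ℕ → Set X := fun n => {x | t < potential G (σ.restrict (K n)) x} ∩ K n with hA
  have hAmono : Monotone A := fun m n hmn => inter_subset_inter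
    (fun x hx => lt_of_lt_of_le hx
      (potential_mono (Measure.restrict_mono (hKmono hmn) le_rfl) x)) (hKmono hmn)
  have hcov : {x | t < potential G σ x} ⊆ ⋃ n, A n := by
    intro x hx
    have h1 : potential G σ x = ⨆ n, potential G (σ.restrict (K n)) x := by
      simp only [potential]
      rw [← setLIntegral_iUnion_of_directed _ hKmono.directed_le, hK, iUnion_compactCovering,
        Measure.restrict_univ]
    have h2 : t < ⨆ n, potential G (σ.restrict (K n)) x := h1 ▸ hx
    obtain ⟨n, hn⟩ := lt_iSup_iff.1 h2
    obtain ⟨m, hm⟩ := mem_iUnion.1 (iUnion_compactCovering X ▸ mem_univ x)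
    refine mem_iUnion.2 ⟨max m n, lt_of_lt_of_le hn (potential_mono
      (Measure.restrict_mono (hKmono (le_max_right m n)) le_rfl) x),
      hKmono (le_max_left m n) hm⟩
  calc σ {x | t < potential G σ x} ≤ σ (⋃ n, A n) := measure_mono hcov
    _ = ⨆ n, σ (A n) := hAmono.measure_iUnion
    _ ≤ B := iSup_le fun n => by
      rw [← Measure.restrict_apply (isOpen_lt_potential hG _ t).measurableSet]
      exact hB _ (hKc n)

theorem memWeakLp_potential_of_weak_type {h C : ℝ≥0} (h1 : 1 ≤ h)
    (hG : LowerSemicontinuous (fun z : X × X => G z.1 z.2))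
    (hh : ∀ ν : Measure X, IsLocallyFiniteMeasure ν → ∀ M : ℝ≥0, 0 < M →
      (∀ x ∈ ν.support, potential G ν x ≤ M) → ∀ x, potential G ν x ≤ (h : ℝ≥0∞) * M)
    {q : ℝ} (hq : 0 < q) (hq1 : q < 1) (σ : Measure X) [IsLocallyFiniteMeasure σ]
    (hC : ∀ ν : Measure X, IsLocallyFiniteMeasure ν →
      weakLpNorm (potential G ν) q σ ≤ (C : ℝ≥0∞) * ν univ) :
    MemWeakLp (potential G σ) (q / (1 - q)) σ := by
  have hq' : 0 < 1 - q := by linarith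
  set r := q / (1 - q) with hr
  have hr0 : 0 < r := div_pos hq hq'
  refine ⟨(measurable_potential hG σ).aemeasurable, ?_⟩
  set D : ℝ := ((2 * h : ℝ) ^ r * (C / h : ℝ) ^ q) ^ (1 / (1 - q)) with hD
  have hD0 : 0 ≤ D := by positivity
  refine lt_of_le_of_lt (iSup_le fun t => ?_) (ENNReal.ofReal_lt_top (r := D ^ (1 / r)))
  rcases (zero_le : 0 ≤ t).eq_or_lt with rfl | ht
  · simp
  have ht' : (0 : ℝ) < t := by exact_mod_cast ht
  have hσ : σ {x | (t : ℝ≥0∞) < potential G σ x} ≤ ENNReal.ofReal (D / (t : ℝ) ^ r) := by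
    refine measure_lt_potential_le_of_forall_isCompact hG σ fun K hK => ?_
    have : IsFiniteMeasure (σ.restrict K) := ⟨by simpa using hK.measure_lt_top⟩
    rw [← ofReal_measureReal]
    refine ENNReal.ofReal_le_ofReal ?_
    rw [le_div_iff₀ (by positivity), mul_comm]
    refine measure_lt_potential_le h1 hG hh hq hq1 (σ.restrict K) (fun ν hν => ?_) ht
    refine le_trans (iSup_mono fun s => ?_) (hC ν hν)
    gcongr
    exact Measure.restrict_le_self
  calc (t : ℝ≥0∞) * σ {x | (t : ℝ≥0∞) < potential G σ x} ^ (1 / r)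
      ≤ ENNReal.ofReal t * ENNReal.ofReal (D / (t : ℝ) ^ r) ^ (1 / r) := by
        rw [ENNReal.ofReal_coe_nnreal]
        gcongr
    _ = ENNReal.ofReal (t * (D / (t : ℝ) ^ r) ^ (1 / r)) := by
        rw [ENNReal.ofReal_rpow_of_nonneg (by positivity) (by positivity),
          ENNReal.ofReal_mul ht'.le]
    _ = ENNReal.ofReal (D ^ (1 / r)) := by
        rw [Real.div_rpow hD0 (by positivity), ← Real.rpow_mul ht'.le,
          mul_one_div_cancel hr0.ne', Real.rpow_one, mul_div_cancel₀ _ ht'.ne']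

end

end KernelPotential

theorem theorem2p10 (n : ℕ) (Ω : Set (EuclideanSpace ℝ (Fin n)))
    (hΩ_open : IsOpen Ω) (hΩ_conn : IsConnected Ω)
    (G : Ω → Ω → ℝ≥0∞) (hG_lsc : LowerSemicontinuous (fun z : Ω × Ω => G z.1 z.2))
    (hG_symm : KernelPotential.QuasiSymmetric G)
    (hG_wmp : KernelPotential.WeakMaximumPrinciple G)
    (σ : Measure Ω) (hσ : IsLocallyFiniteMeasure σ)
    (q : ℝ) (hq_pos : 0 < q) (hq_lt : q < 1) :
    List.TFAE [
      ∃ C : ℝ≥0, 0 < C ∧ ∀ ν : Measure Ω, IsLocallyFiniteMeasure ν →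
        KernelPotential.weakLpNorm (KernelPotential.potential G ν) q σ
          ≤ (C : ℝ≥0∞) * ν Set.univ,
      ∃ c : ℝ≥0, 0 < c ∧ ∀ K : Set Ω, IsCompact K →
        σ K ≤ (c : ℝ≥0∞) * KernelPotential.innerCapacity G K ^ q,
      KernelPotential.MemWeakLp (KernelPotential.potential G σ) (q / (1 - q)) σ] := by
  have : LocallyCompactSpace Ω := hΩ_open.locallyCompactSpace
  obtain ⟨a, ha0, ha⟩ := hG_symm
  obtain ⟨h, h1, hh⟩ := hG_wmp
  tfae_have 1 → 3 := by
    rintro ⟨C, -, hC⟩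
    exact KernelPotential.memWeakLp_potential_of_weak_type h1 hG_lsc hh hq_pos hq_lt σ hC
  tfae_have 3 → 2 := by
    rintro ⟨-, hfin⟩
    obtain ⟨A, hA, -⟩ := ENNReal.lt_iff_exists_nnreal_btwn.1 hfin
    have hA0 : 0 < A := ENNReal.coe_pos.1 (bot_le.trans_lt hA)
    exact ⟨2 * A ^ q, by positivity, fun K hK =>
      KernelPotential.measure_le_innerCapacity_of_memWeakLp hG_lsc σ hq_pos hq_lt hA0 hA hK⟩
  tfae_have 2 → 1 := by
    rintro ⟨c, hc0, hc⟩
    have hh0 : 0 < h := lt_of_lt_of_le one_pos h1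
    have hC0 : 0 < c ^ (1 / q) * (4 * a * h) := by positivity
    refine ⟨c ^ (1 / q) * (4 * a * h), hC0, fun ν hν => ?_⟩
    rcases eq_or_ne (ν Set.univ) ∞ with htop | hfin
    · rw [htop, ENNReal.mul_top (by exact_mod_cast hC0.ne')]
      exact le_top
    have : IsFiniteMeasure ν := ⟨lt_top_iff_ne_top.2 hfin⟩
    refine (KernelPotential.weakLpNorm_potential_le_of_capacity_bound hG_lsc
      (fun x y => (ha x y).2) hh σ hq_pos hc ν).trans_eq ?_
    push_cast
    rw [ENNReal.coe_rpow_of_nonneg _ (by positivity)]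
    ring
  tfae_finish
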